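/- Let $m\in\mathbb N$ and let $f:[0,\infty)\times\mathbb R^m\to\mathbb R^m$ (the restriction of a $C^1$ map on $\mathbb R\times\mathbb R^m$) and $u:\mathbb R^m\to\mathbb R^m$ be continuously differentiable. Consider the pair of unidirectionally coupled systems $$\dot x=f(t,x),\qquad \dot y=f(t,y)+u(x)-u(y),\qquad t\ge 0 .$$ A system $\dot y=g(t,y)$ on $\mathbb R^m$ is called contracting over the entire state space if there are constants $\varepsilon,\beta>0$ and a continuously differentiable field $M(t,y)$ of symmetric $m\times m$ matrices such that, for all $t\ge 0$ and all $y\in\mathbb R^m$, $M\succeq\varepsilon I$ and $$\Big(\frac{\partial g}{\partial y}\Big)^{T}M+M\,\frac{\partial g}{\partial y}+\dot M\preceq-\beta M,\qquad \dot M=\frac{\partial M}{\partial y}\,g(t,y)+\frac{\partial M}{\partial t}.$$ Suppose that for every continuously differentiable signal $\xi:[0,\infty)\to\mathbb R^m$ the driven system $\dot y=f(t,y)-u(y)+u(\xi(t))$, with state $y$ and input $u(\xi(t))$, is contracting over the entire state space ($M,\varepsilon,\beta$ may depend on $\xi$). Then the two systems synchronize regardless of initial conditions: for every solution $x$ of the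 first system on $[0,\infty)$ and every $y_0\in\mathbb R^m$, the second system has a solution $y$ on $[0,\infty)$ with $y(0)=y_0$, and every solution $y$ of the second system on $[0,\infty)$ satisfies $y(t)-x(t)\to 0$ as $t\to\infty$. -/

import Mathlib

open Set Filter Topology

noncomputable section

namespace Contraction

/-- The state space `ℝ^m` with its Euclidean norm. -/
abbrev State (m : ℕ) : Type := EuclideanSpace ℝ (Fin m)

/-- The Jacobian matrix `∂g/∂y (t, y)` of a time-dependent vector field `g` with respect to the
state. -/
def jacobian {m : ℕ} (g : ℝ → State m → State m) (t : ℝ) (y : State m) :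
    Matrix (Fin m) (Fin m) ℝ :=
  Matrix.of fun i j => fderiv ℝ (g t) y (EuclideanSpace.single j 1) i

/-- The rate of change `Ṁ = (∂M/∂y) g(t, y) + ∂M/∂t` of `M` along the system `ẏ = g(t, y)`,
entry by entry: the derivative of `M` at `(t, y)` in the direction `(1, g(t, y))`. -/
def metricDot {m : ℕ} (g : ℝ → State m → State m) (M : ℝ → State m → Matrix (Fin m) (Fin m) ℝ)
    (t : ℝ) (y : State m) : Matrix (Fin m) (Fin m) ℝ :=
  Matrix.of fun i j => fderiv ℝ (fun p : ℝ × State m => M p.1 p.2 i j) (t, y) (1, g t y)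

/-- The metric variation `R = (∂g/∂y)ᵀ M + M (∂g/∂y) + Ṁ`. -/
def metricVariation {m : ℕ} (g : ℝ → State m → State m)
    (M : ℝ → State m → Matrix (Fin m) (Fin m) ℝ) (t : ℝ) (y : State m) :
    Matrix (Fin m) (Fin m) ℝ :=
  (jacobian g t y).transpose * M t y + M t y * jacobian g t y + metricDot g M t y

/-- A continuously differentiable, symmetric, uniformly positive definite metric:
`M(t, y) ⪰ ε I` for one `ε > 0`, all `t ≥ 0` and all `y`
(`Matrix.PosSemidef` includes symmetry). -/
structure IsUniformMetric {m : ℕ} (M : ℝ → State m → Matrix (Fin m) (Fin m) ℝ) : Prop where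
  contDiff : ∀ i j, ContDiff ℝ 1 fun p : ℝ × State m => M p.1 p.2 i j
  posDef : ∃ ε : ℝ, 0 < ε ∧ ∀ t : ℝ, 0 ≤ t → ∀ y : State m,
    (M t y - ε • (1 : Matrix (Fin m) (Fin m) ℝ)).PosSemidef

/-- `S` is a contraction region of `ẏ = g(t, y)` with respect to the metric `M`: the metric
variation is uniformly negative definite relative to the metric, `R ⪯ -β M` on `S` for one
`β > 0` and all `t ≥ 0`. -/
def IsContractionRegion {m : ℕ} (g : ℝ → State m → State m)
    (M : ℝ → State m → Matrix (Fin m) (Fin m) ℝ) (S : Set (State m)) : Prop :=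
  ∃ β : ℝ, 0 < β ∧ ∀ t : ℝ, 0 ≤ t → ∀ y ∈ S,
    (-(β • M t y) - metricVariation g M t y).PosSemidef

/-- The system `ẏ = g(t, y)` is contracting over the entire state space: the whole space is a
contraction region for some uniformly positive definite metric. -/
def IsContracting {m : ℕ} (g : ℝ → State m → State m) : Prop :=
  ∃ M : ℝ → State m → Matrix (Fin m) (Fin m) ℝ,
    IsUniformMetric M ∧ IsContractionRegion g M univ

/-- The vector field `f(t, y) + u(ξ(t)) - u(y)` of the second oscillator when it is driven by the
signal `ξ`. -/
def drivenField {m : ℕ} (f : ℝ → State m → State m) (u : State m → State m) (ξ : ℝ → State m) :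
    ℝ → State m → State m :=
  fun t y => f t y + u (ξ t) - u y

/-- The `y`-system is contracting with respect to `y` for an arbitrary input `u(ξ(t))`. The metric
may depend on the input. -/
def IsContractingForAllInputs {m : ℕ} (f : ℝ → State m → State m) (u : State m → State m) :
    Prop :=
  ∀ ξ : ℝ → State m, ContDiffOn ℝ 1 ξ (Ici 0) → IsContracting (drivenField f u ξ)

end Contraction

end

/-! The coupling vanishes at `y = x`, so `x` itself solves the second system. Since `x` is `C¹`, it
is an admissible input, and the resulting driven field has the form `F t y + w t` with `F = f - u`
of class `C¹` and `w = u ∘ x` continuous. It remains to show that solutions of this one contracting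
system exist for all time and approach `x`.

For neighbouring solutions `a`, `b` with `d = b - a`, let `V = dᵀ M(t, a) d`. Then `V'` is the
metric variation at `d`, at most `-β V`, plus a linearization error that is absorbed while `d` is
small (`mul_norm_sub_sq_le`). To reach a distant `y₀`, the segment from `x 0` to `y₀` is cut into
`N` steps and the estimates are added along the chain (`exists_isIntegralCurveOn_norm_sub_le`).

`M` need not be bounded above, so `N` depends on the horizon `T`. The total bound does not: it
involves only `ε`, the step lengths, and the size of `M` at time 0 on the segment. The same estimate
excludes blow-up: each new curve solves a truncated equation and is then shown never to reach the
truncation. -/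

noncomputable section

namespace Contraction

/-! ### Uniform linearization, uniqueness and truncation for `C¹` fields. -/

section Analysis

variable {E : Type*} [NormedAddCommGroup E] [InnerProductSpace ℝ E] [FiniteDimensional ℝ E]

/-- A `C¹` map is Lipschitz in the state, uniformly for times and states in compact sets. -/
theorem exists_lipschitzOnWith_closedBall {F : ℝ → E → E}
    (hF : ContDiff ℝ 1 fun p : ℝ × E => F p.1 p.2) (T P : ℝ) :
    ∃ K, ∀ t ∈ Icc 0 T, LipschitzOnWith K (F t) (Metric.closedBall 0 P) := by
  obtain ⟨K, hK⟩ := hF.contDiffOn.exists_lipschitzOnWith one_ne_zero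
    ((convex_Icc (0 : ℝ) T).prod (convex_closedBall (0 : E) P))
    (isCompact_Icc.prod (isCompact_closedBall _ _))
  refine ⟨K, fun t ht y hy z hz => ?_⟩
  simpa [Prod.edist_eq] using hK (show (t, y) ∈ _ from ⟨ht, hy⟩) (show (t, z) ∈ _ from ⟨ht, hz⟩)

/-- The first order expansion of a `C¹` map in the state is uniform on compact sets. -/
theorem exists_uniform_linearization {F : ℝ → E → E}
    (hF : ContDiff ℝ 1 fun p : ℝ × E => F p.1 p.2) (T P : ℝ) {η : ℝ} (hη : 0 < η) :
    ∃ r > 0, ∀ t ∈ Icc 0 T, ∀ y ∈ Metric.closedBall (0 : E) P, ∀ z ∈ Metric.closedBall (0 : E) P,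
      ‖z - y‖ ≤ r → ‖F t z - F t y - fderiv ℝ (F t) y (z - y)‖ ≤ η * ‖z - y‖ := by
  have hD : Continuous fun p : ℝ × E => fderiv ℝ (F p.1) p.2 := by
    have h : ContDiff ℝ 0 fun p : ℝ × E => fderiv ℝ (F p.1) p.2 := by
      refine ContDiff.fderiv (f := fun p : ℝ × E => F p.1) (m := 1) ?_ contDiff_snd (by simp)
      exact hF.comp (contDiff_fst.fst.prodMk contDiff_snd)
    exact h.continuous
  have hFt : ∀ t, Differentiable ℝ (F t) := fun t =>
    (hF.comp (contDiff_prodMk_right t)).differentiable one_ne_zero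
  have hcomp : IsCompact (Icc (0 : ℝ) T ×ˢ Metric.closedBall (0 : E) P) :=
    isCompact_Icc.prod (isCompact_closedBall _ _)
  have huc := hcomp.uniformContinuousOn_of_continuous hD.continuousOn
  obtain ⟨δ, hδ, h⟩ := Metric.uniformContinuousOn_iff_le.1 huc η hη
  refine ⟨δ, hδ, fun t ht y hy z hz hyz => ?_⟩
  -- Mean value inequality for `F t` minus its linear part at `y`, on a convex set where the
  -- derivative varies by at most `η`.
  refine Convex.norm_image_sub_le_of_norm_fderiv_le'
    (s := Metric.closedBall (0 : E) P ∩ Metric.closedBall y δ)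
    (fun w _ => hFt t w) (fun w hw => ?_)
    ((convex_closedBall _ _).inter (convex_closedBall _ _))
    ⟨hy, Metric.mem_closedBall_self hδ.le⟩ ⟨hz, by simpa [dist_eq_norm] using hyz⟩
  have := h (t, w) ⟨ht, hw.1⟩ (t, y) ⟨ht, hy⟩ (by simpa [Prod.dist_eq, hδ.le] using hw.2)
  simpa [dist_eq_norm] using this

/-- Integral curves on `[0, T]` of `F t y + w t` are determined by their initial value. -/
theorem eqOn_of_isIntegralCurveOn {F : ℝ → E → E}
    (hF : ContDiff ℝ 1 fun p : ℝ × E => F p.1 p.2) {w : ℝ → E} {T : ℝ} {y z : ℝ → E}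
    (hy : IsIntegralCurveOn y (fun t p => F t p + w t) (Icc 0 T))
    (hz : IsIntegralCurveOn z (fun t p => F t p + w t) (Icc 0 T)) (h0 : y 0 = z 0) :
    EqOn y z (Icc 0 T) := by
  obtain ⟨Cy, hCy⟩ := isCompact_Icc.exists_bound_of_continuousOn hy.continuousOn
  obtain ⟨Cz, hCz⟩ := isCompact_Icc.exists_bound_of_continuousOn hz.continuousOn
  obtain ⟨K, hK⟩ := exists_lipschitzOnWith_closedBall hF T (max Cy Cz)
  have hder : ∀ {v : ℝ → E}, IsIntegralCurveOn v (fun t p => F t p + w t) (Icc 0 T) →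
      ∀ t ∈ Ico 0 T, HasDerivWithinAt v (F t (v t) + w t) (Ici t) t := fun hv t ht =>
    (hv t (Ico_subset_Icc_self ht)).mono_of_mem_nhdsWithin (Icc_mem_nhdsGE_of_mem ht)
  refine ODE_solution_unique_of_mem_Icc_right (v := fun t p => F t p + w t)
    (s := fun _ => Metric.closedBall 0 (max Cy Cz)) (K := K) (fun t ht => ?_) hy.continuousOn
    (hder hy) (fun t ht => ?_) hz.continuousOn (hder hz) (fun t ht => ?_) h0
  · intro p hp q hq
    simpa using hK t (Ico_subset_Icc_self ht) hp hq
  · simpa using Or.inl (hCy t (Ico_subset_Icc_self ht))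
  · simpa using Or.inr (hCz t (Ico_subset_Icc_self ht))

/-- Away from a ball, the field `F t y + w t` can be changed so that every initial value problem
has a solution on `[0, T]`. -/
theorem exists_truncation {F : ℝ → E → E}
    (hF : ContDiff ℝ 1 fun p : ℝ × E => F p.1 p.2) {w : ℝ → E} {T P : ℝ} (hT : 0 ≤ T) (hP : 0 < P)
    (hw : ContinuousOn w (Icc 0 T)) :
    ∃ v : ℝ → E → E, (∀ t, ∀ y ∈ Metric.closedBall (0 : E) P, v t y = F t y + w t) ∧
      ∀ y₀, ∃ y : ℝ → E, y 0 = y₀ ∧ IsIntegralCurveOn y v (Icc 0 T) := by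
  let φ : ContDiffBump (0 : E) := ⟨P, P + 1, hP, by linarith⟩
  obtain ⟨CF, hCF⟩ := (isCompact_Icc.prod (isCompact_closedBall (0 : E) (P + 1))
    ).exists_bound_of_continuousOn (s := Icc (0 : ℝ) T ×ˢ Metric.closedBall (0 : E) (P + 1))
    hF.continuous.continuousOn
  obtain ⟨Cw, hCw⟩ := isCompact_Icc.exists_bound_of_continuousOn hw
  refine ⟨fun t y => φ y • (F t y + w t), fun t y hy => ?_, fun y₀ => ?_⟩
  · simp [φ.one_of_mem_closedBall hy]
  -- `w` is only continuous. Treating its value as a further variable gives a `C¹` map, hence a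
  -- Lipschitz constant in `y` uniform in `t`.
  have hH : ContDiff ℝ 1 fun p : ℝ × E × E => φ p.2.1 • (F p.1 p.2.1 + p.2.2) :=
    (φ.contDiff.comp contDiff_snd.fst).smul
      ((hF.comp (contDiff_fst.prodMk contDiff_snd.fst)).add contDiff_snd.snd)
  have hC : 0 ≤ max (CF + Cw) 0 := le_max_right _ _
  have ha : 0 ≤ max (CF + Cw) 0 * T := mul_nonneg hC hT
  obtain ⟨K, hK⟩ := hH.contDiffOn.exists_lipschitzOnWith one_ne_zero
    ((convex_Icc (0 : ℝ) T).prod ((convex_closedBall y₀ (max (CF + Cw) 0 * T)).prod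
      (convex_closedBall (0 : E) Cw)))
    (isCompact_Icc.prod ((isCompact_closedBall _ _).prod (isCompact_closedBall _ _)))
  -- The truncated field is globally bounded, so a ball of radius bound times `T` lets
  -- Picard–Lindelöf cover all of `[0, T]` at once.
  have hPL : IsPicardLindelof (fun t y => φ y • (F t y + w t))
      (⟨0, le_rfl, hT⟩ : Icc (0 : ℝ) T) y₀ ⟨_, ha⟩ 0 ⟨_, hC⟩ K := by
    refine ⟨fun t ht y hy z hz => ?_, fun y hy => ?_, fun t ht y hy => ?_, ?_⟩
    · have hwt : w t ∈ Metric.closedBall (0 : E) Cw := by simpa using hCw t ht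
      simpa [Prod.edist_eq] using hK (show (t, y, w t) ∈ _ from ⟨ht, hy, hwt⟩)
        (show (t, z, w t) ∈ _ from ⟨ht, hz, hwt⟩)
    · have : Continuous fun t => F t y := hF.continuous.comp (Continuous.prodMk_left y)
      exact continuousOn_const.smul (this.continuousOn.add hw)
    · show ‖φ y • (F t y + w t)‖ ≤ max (CF + Cw) 0
      by_cases hyP : y ∈ Metric.closedBall (0 : E) (P + 1)
      · rw [norm_smul, Real.norm_of_nonneg φ.nonneg]
        calc φ y * ‖F t y + w t‖ ≤ 1 * ‖F t y + w t‖ := by gcongr; exact φ.le_one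
          _ ≤ CF + Cw := by
            rw [one_mul]
            exact (norm_add_le _ _).trans (add_le_add (hCF (t, y) ⟨ht, hyP⟩) (hCw t ht))
          _ ≤ _ := le_max_left _ _
      · have : φ y = 0 := φ.zero_of_le_dist (by simpa using (not_le.1 (by simpa using hyP)).le)
        simp [this]
    · simp only [sub_zero, NNReal.coe_zero, sub_self]
      exact (congrArg _ (max_eq_left hT)).le
  obtain ⟨y, h0, hy⟩ := hPL.exists_eq_forall_mem_Icc_hasDerivWithinAt₀
  exact ⟨y, h0, hy⟩

end Analysis

/-! ### The quadratic form of the metric. -/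

open Matrix in
/-- The bilinear form `dᵀ A e`. -/
def bilin {m : ℕ} (A : Matrix (Fin m) (Fin m) ℝ) (d e : State m) : ℝ :=
  d.ofLp ⬝ᵥ A *ᵥ e.ofLp

section Bilin

variable {m : ℕ}

theorem bilin_eq_sum (A : Matrix (Fin m) (Fin m) ℝ) (d e : State m) :
    bilin A d e = ∑ i, ∑ j, d i * A i j * e j := by
  simp [bilin, dotProduct, Matrix.mulVec, Finset.mul_sum, mul_assoc]

theorem bilin_add_left (A : Matrix (Fin m) (Fin m) ℝ) (d d' e : State m) :
    bilin A (d + d') e = bilin A d e + bilin A d' e := by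
  simp [bilin, add_dotProduct]

theorem bilin_add_right (A : Matrix (Fin m) (Fin m) ℝ) (d e e' : State m) :
    bilin A d (e + e') = bilin A d e + bilin A d e' := by
  simp [bilin, Matrix.mulVec_add, dotProduct_add]

/-- The entry sum is a crude norm, chosen because it is visibly continuous in the entries and so
bounded on compact sets. -/
theorem abs_bilin_le (A : Matrix (Fin m) (Fin m) ℝ) (d e : State m) :
    |bilin A d e| ≤ (∑ i, ∑ j, |A i j|) * (‖d‖ * ‖e‖) := by
  rw [bilin_eq_sum, Finset.sum_mul]
  refine (Finset.abs_sum_le_sum_abs _ _).trans (Finset.sum_le_sum fun i _ => ?_)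
  rw [Finset.sum_mul]
  refine (Finset.abs_sum_le_sum_abs _ _).trans (Finset.sum_le_sum fun j _ => ?_)
  have hd : |d i| ≤ ‖d‖ := PiLp.norm_apply_le d i
  have he : |e j| ≤ ‖e‖ := PiLp.norm_apply_le e j
  rw [abs_mul, abs_mul]
  calc |d i| * |A i j| * |e j| = |A i j| * (|d i| * |e j|) := by ring
    _ ≤ _ := by gcongr

theorem bilin_one_self (d : State m) : bilin 1 d d = ‖d‖ ^ 2 := by
  rw [bilin, Matrix.one_mulVec, EuclideanSpace.real_norm_sq_eq]
  simp [dotProduct, sq]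

theorem bilin_nonneg {A : Matrix (Fin m) (Fin m) ℝ} (hA : A.PosSemidef) (d : State m) :
    0 ≤ bilin A d d := by
  simpa [bilin] using hA.dotProduct_mulVec_nonneg d.ofLp

theorem mul_norm_sq_le_bilin {A : Matrix (Fin m) (Fin m) ℝ} {ε : ℝ}
    (hA : (A - ε • (1 : Matrix (Fin m) (Fin m) ℝ)).PosSemidef) (d : State m) :
    ε * ‖d‖ ^ 2 ≤ bilin A d d := by
  have h := bilin_nonneg hA d
  have h1 := bilin_one_self d
  simp only [bilin, Matrix.sub_mulVec, Matrix.smul_mulVec, dotProduct_sub, dotProduct_smul,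
    smul_eq_mul] at h h1 ⊢
  rw [h1] at h
  linarith

theorem jacobian_mulVec (g : ℝ → State m → State m) (t : ℝ) (y d : State m) :
    Matrix.mulVec (jacobian g t y) d.ofLp = (fderiv ℝ (g t) y d).ofLp := by
  ext i
  have hd : d = ∑ j, d j • EuclideanSpace.single j (1 : ℝ) := by
    ext k
    simp [Pi.single_apply]
  conv_rhs => rw [hd, map_sum]
  simp [Matrix.mulVec, dotProduct, jacobian, mul_comm]

/-- The right side is the derivative of `dᵀ M d` along the flow when `d` obeys the linearized
equation. -/
theorem bilin_metricVariation (g : ℝ → State m → State m)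
    (M : ℝ → State m → Matrix (Fin m) (Fin m) ℝ) (t : ℝ) (y d : State m) :
    bilin (metricVariation g M t y) d d = bilin (metricDot g M t y) d d +
      bilin (M t y) (fderiv ℝ (g t) y d) d + bilin (M t y) d (fderiv ℝ (g t) y d) := by
  simp only [bilin, metricVariation, Matrix.add_mulVec, dotProduct_add, ← Matrix.mulVec_mulVec,
    jacobian_mulVec]
  rw [Matrix.dotProduct_mulVec, Matrix.vecMul_transpose, jacobian_mulVec]
  ring

theorem bilin_metricVariation_le {g : ℝ → State m → State m}
    {M : ℝ → State m → Matrix (Fin m) (Fin m) ℝ} {t β : ℝ} {y : State m}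
    (h : (-(β • M t y) - metricVariation g M t y).PosSemidef) (d : State m) :
    bilin (metricVariation g M t y) d d ≤ -β * bilin (M t y) d d := by
  have h := bilin_nonneg h d
  simp only [bilin, Matrix.sub_mulVec, Matrix.neg_mulVec, Matrix.smul_mulVec, dotProduct_sub,
    dotProduct_neg, dotProduct_smul, smul_eq_mul] at h ⊢
  linarith

/-- The derivative of `dᵀ M(t, a(t)) d` along an integral curve `a` of `g`. -/
theorem hasDerivWithinAt_bilin {g : ℝ → State m → State m}
    {M : ℝ → State m → Matrix (Fin m) (Fin m) ℝ}
    (hM : ∀ i j, ContDiff ℝ 1 fun p : ℝ × State m => M p.1 p.2 i j)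
    {a d : ℝ → State m} {d' : State m} {s : Set ℝ} {t : ℝ}
    (ha : HasDerivWithinAt a (g t (a t)) s t) (hd : HasDerivWithinAt d d' s t) :
    HasDerivWithinAt (fun τ => bilin (M τ (a τ)) (d τ) (d τ))
      (bilin (metricDot g M t (a t)) (d t) (d t) + bilin (M t (a t)) d' (d t) +
        bilin (M t (a t)) (d t) d') s t := by
  have hdi : ∀ i, HasDerivWithinAt (fun τ => d τ i) (d' i) s t := fun i =>
    ((EuclideanSpace.proj i : State m →L[ℝ] ℝ).hasFDerivAt).comp_hasDerivWithinAt t hd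
  have hMij : ∀ i j, HasDerivWithinAt (fun τ => M τ (a τ) i j)
      (metricDot g M t (a t) i j) s t := fun i j =>
    HasFDerivAt.comp_hasDerivWithinAt (l := fun p : ℝ × State m => M p.1 p.2 i j)
      (f := fun τ => (τ, a τ)) t (((hM i j).differentiable one_ne_zero (t, a t)).hasFDerivAt)
      ((hasDerivWithinAt_id t s).prodMk ha)
  simp only [bilin_eq_sum, ← Finset.sum_add_distrib]
  refine HasDerivWithinAt.fun_sum fun i _ => HasDerivWithinAt.fun_sum fun j _ => ?_
  convert! ((hdi i).mul (hMij i j)).mul (hdi j) using 1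
  simp only [Pi.mul_apply]
  ring

end Bilin

/-! ### Decay of the distance between neighbouring solutions. -/

section Contracting

variable {m : ℕ}

/-- Nearby integral curves approach each other exponentially. The second curve need only follow a
field `v` that agrees with `g` on a ball. -/
theorem mul_norm_sub_sq_le {g v : ℝ → State m → State m}
    {M : ℝ → State m → Matrix (Fin m) (Fin m) ℝ}
    (hM : ∀ i j, ContDiff ℝ 1 fun p : ℝ × State m => M p.1 p.2 i j)
    {T P r ε β η S B₀ : ℝ} (hε : 0 < ε) (hβ : 0 < β) (hr : 0 ≤ r) (hB₀ : 0 < B₀)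
    (hpos : ∀ t : ℝ, 0 ≤ t → ∀ y, (M t y - ε • (1 : Matrix (Fin m) (Fin m) ℝ)).PosSemidef)
    (hvar : ∀ t : ℝ, 0 ≤ t → ∀ y, (-(β • M t y) - metricVariation g M t y).PosSemidef)
    (hlin : ∀ t ∈ Icc 0 T, ∀ y ∈ Metric.closedBall (0 : State m) P,
      ∀ z ∈ Metric.closedBall (0 : State m) P,
      ‖z - y‖ ≤ r → ‖g t z - g t y - fderiv ℝ (g t) y (z - y)‖ ≤ η * ‖z - y‖)
    (hS : ∀ t ∈ Icc 0 T, ∀ y ∈ Metric.closedBall (0 : State m) P, ∑ i, ∑ j, |M t y i j| ≤ S)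
    (hS0 : 0 ≤ S) (hη : 2 * S * η ≤ β / 2 * ε)
    (hv : ∀ t, ∀ y ∈ Metric.closedBall (0 : State m) P, v t y = g t y)
    {a b : ℝ → State m} (ha : IsIntegralCurveOn a g (Icc 0 T))
    (hb : IsIntegralCurveOn b v (Icc 0 T)) (haP : ∀ t ∈ Icc 0 T, ‖a t‖ ≤ P - r)
    (h0 : bilin (M 0 (a 0)) (b 0 - a 0) (b 0 - a 0) ≤ B₀) (hB₀r : B₀ ≤ ε * r ^ 2) :
    ∀ t ∈ Icc 0 T, ε * ‖b t - a t‖ ^ 2 ≤ B₀ * Real.exp (-(β / 4) * t) := by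
  have hder : ∀ t ∈ Icc 0 T, HasDerivWithinAt
      (fun τ => bilin (M τ (a τ)) (b τ - a τ) (b τ - a τ))
      (bilin (metricDot g M t (a t)) (b t - a t) (b t - a t) +
        bilin (M t (a t)) (v t (b t) - g t (a t)) (b t - a t) +
        bilin (M t (a t)) (b t - a t) (v t (b t) - g t (a t))) (Icc 0 T) t := fun t ht =>
    hasDerivWithinAt_bilin hM (d := fun τ => b τ - a τ) (ha t ht) ((hb t ht).sub (ha t ht))
  have hB : ∀ t, HasDerivAt (fun t => B₀ * Real.exp (-(β / 4) * t))
      (-(β / 4) * (B₀ * Real.exp (-(β / 4) * t))) t := fun t => by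
    have := (((hasDerivAt_id t).const_mul (-(β / 4))).exp).const_mul B₀
    convert! this using 1
    simp only [id]
    ring
  -- Barrier argument: `V' < B'` is needed only at times where `V = B`. There `V ≤ B₀ ≤ ε r²` forces
  -- `‖d‖ ≤ r`, so the linearization applies and `v` agrees with `g` at `b t`. Strictness comes from
  -- `V' ≤ -(β/2) V` against the barrier rate `β/4`, with `B₀ > 0`.
  have key := image_le_of_deriv_right_lt_deriv_boundary
    (fun t ht => (hder t ht).continuousWithinAt)
    (fun t ht => (hder t (Ico_subset_Icc_self ht)).mono_of_mem_nhdsWithin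
      (Icc_mem_nhdsGE_of_mem ht)) (by simpa using h0) hB ?_
  · intro t ht
    exact (mul_norm_sq_le_bilin (hpos t ht.1 (a t)) _).trans (key ht)
  intro t ht hVB
  have ht' := Ico_subset_Icc_self ht
  have hexp : Real.exp (-(β / 4) * t) ≤ 1 := Real.exp_le_one_iff.2 (by nlinarith [ht.1])
  have hBpos : 0 < B₀ * Real.exp (-(β / 4) * t) := by positivity
  have hBle : B₀ * Real.exp (-(β / 4) * t) ≤ B₀ := mul_le_of_le_one_right hB₀.le hexp
  have hlow := mul_norm_sq_le_bilin (hpos t ht.1 (a t)) (b t - a t)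
  have hup := bilin_metricVariation_le (hvar t ht.1 (a t)) (b t - a t)
  have hdr : ‖b t - a t‖ ≤ r :=
    (sq_le_sq₀ (norm_nonneg _) hr).1 (le_of_mul_le_mul_left (by linarith) hε)
  have haB : a t ∈ Metric.closedBall (0 : State m) P := by
    simpa using (haP t ht').trans (by linarith)
  have hbB : b t ∈ Metric.closedBall (0 : State m) P := by
    have := norm_le_norm_add_norm_sub' (b t) (a t)
    have := haP t ht'
    simp only [mem_closedBall_zero_iff]
    linarith
  have he := hlin t ht' _ haB _ hbB hdr
  have hSt := hS t ht' _ haB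
  rw [bilin_metricVariation] at hup
  rw [hv t _ hbB, ← hVB]
  rw [← hVB] at hBpos
  generalize b t - a t = d at *
  -- `e` is the linearization error. It contributes at most `2 S η ‖d‖² ≤ (β/2) ε ‖d‖² ≤ (β/2) V` to
  -- `V'`.
  obtain ⟨e, hgd⟩ : ∃ e, g t (b t) - g t (a t) = fderiv ℝ (g t) (a t) d + e := 
    ⟨_, (add_sub_cancel _ _).symm⟩
  rw [hgd, add_sub_cancel_left] at he
  rw [hgd, bilin_add_left, bilin_add_right]
  have hed : ‖e‖ * ‖d‖ ≤ η * ‖d‖ ^ 2 := by nlinarith [norm_nonneg d]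
  have hSed : (∑ i, ∑ j, |M t (a t) i j|) * (‖e‖ * ‖d‖) ≤ S * (η * ‖d‖ ^ 2) := by
    refine mul_le_mul hSt hed (by positivity) hS0
  have h1 := (le_abs_self _).trans (abs_bilin_le (M t (a t)) e d)
  have h2 := (le_abs_self _).trans (abs_bilin_le (M t (a t)) d e)
  rw [mul_comm ‖d‖] at h2
  have h3 : 2 * S * η * ‖d‖ ^ 2 ≤ β / 2 * ε * ‖d‖ ^ 2 := by gcongr
  nlinarith

end Contracting

/-! ### Chains of solutions and continuation to all times. -/

section Synchronization

variable {m : ℕ}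

/-- Taking square roots halves the rate, which turns the `β/4` of the energy into `β/8`. -/
theorem norm_le_of_mul_sq_le {E : Type*} [SeminormedAddCommGroup E] {d : E} {ε c h γ s : ℝ}
    (hε : 0 < ε) (hc : 0 ≤ c) (hh : 0 ≤ h)
    (H : ε * ‖d‖ ^ 2 ≤ c * h ^ 2 * Real.exp (-(2 * γ) * s)) :
    ‖d‖ ≤ √(c / ε) * h * Real.exp (-γ * s) := by
  refine (sq_le_sq₀ (norm_nonneg _) (by positivity)).1 (le_of_mul_le_mul_left (H.trans ?_) hε)
  rw [mul_pow, mul_pow, Real.sq_sqrt (by positivity), ← Real.exp_nat_mul]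
  apply le_of_eq
  push_cast
  rw [show (2 : ℝ) * (-γ * s) = -(2 * γ) * s by ring]
  field_simp

/-- In a contracting system `F t y + w t`, every initial value can be continued up to time `T`
along a given integral curve `x`, with a bound on the distance to `x` that does not depend
on `T`. -/
theorem exists_isIntegralCurveOn_norm_sub_le {F : ℝ → State m → State m}
    (hF : ContDiff ℝ 1 fun p : ℝ × State m => F p.1 p.2) {w : ℝ → State m}
    {M : ℝ → State m → Matrix (Fin m) (Fin m) ℝ}
    (hM : ∀ i j, ContDiff ℝ 1 fun p : ℝ × State m => M p.1 p.2 i j)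
    {T ε β C₀ D : ℝ} (hT : 0 ≤ T) (hε : 0 < ε) (hβ : 0 < β) (hC₀ : 0 < C₀) (hD : 0 < D)
    (hpos : ∀ t : ℝ, 0 ≤ t → ∀ y, (M t y - ε • (1 : Matrix (Fin m) (Fin m) ℝ)).PosSemidef)
    (hvar : ∀ t : ℝ, 0 ≤ t → ∀ y,
      (-(β • M t y) - metricVariation (fun t y => F t y + w t) M t y).PosSemidef)
    (hw : ContinuousOn w (Icc 0 T)) {x : ℝ → State m}
    (hx : IsIntegralCurveOn x (fun t y => F t y + w t) (Icc 0 T)) {y₀ : State m}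
    (hy₀ : ‖y₀ - x 0‖ ≤ D)
    (hseg : ∀ s ∈ Icc (0 : ℝ) 1, ∑ i, ∑ j, |M 0 (x 0 + s • (y₀ - x 0)) i j| ≤ C₀) :
    ∃ y : ℝ → State m, y 0 = y₀ ∧ IsIntegralCurveOn y (fun t y => F t y + w t) (Icc 0 T) ∧
      ∀ t ∈ Icc 0 T, ‖y t - x t‖ ≤ √(C₀ / ε) * D * Real.exp (-(β / 8) * t) := by
  set L := √(C₀ / ε) * D with hL
  have hL0 : 0 < L := by positivity
  obtain ⟨Bx, hBx⟩ := isCompact_Icc.exists_bound_of_continuousOn hx.continuousOn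
  have hBx0 : 0 ≤ Bx := (norm_nonneg _).trans (hBx 0 ⟨le_rfl, hT⟩)
  -- Room for `x`, for the total chain length `L`, and for one more step of length `r ≤ 1`.
  set P := Bx + L + 1 with hP
  have hMc : Continuous fun p : ℝ × State m => ∑ i, ∑ j, |M p.1 p.2 i j| :=
    continuous_finsetSum _ fun i _ => continuous_finsetSum _ fun j _ => (hM i j).continuous.abs
  obtain ⟨S, hS⟩ := (isCompact_Icc.prod (isCompact_closedBall (0 : State m) P)
    ).exists_bound_of_continuousOn (s := Icc (0 : ℝ) T ×ˢ Metric.closedBall (0 : State m) P)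
    hMc.continuousOn
  have hS0 : 0 ≤ S := (norm_nonneg _).trans
    (hS (0, 0) ⟨⟨le_rfl, hT⟩, Metric.mem_closedBall_self (by positivity)⟩)
  -- This `η` gives `2 S η ≤ (β/2) ε`; using `S + 1` avoids division by zero.
  obtain ⟨r₀, hr₀, hlin⟩ := exists_uniform_linearization hF T P
    (η := β * ε / (4 * (S + 1))) (by positivity)
  obtain ⟨v, hv, hvex⟩ := exists_truncation hF (P := P) hT (by positivity) hw
  set r := min r₀ 1 with hr
  have hr0 : 0 < r := lt_min hr₀ one_pos
  obtain ⟨N, hN⟩ := exists_nat_gt (L / r)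
  have hN0 : (0 : ℝ) < N := (by positivity : 0 < L / r).trans hN
  have hLN : L / N ≤ r := by
    rw [div_lt_iff₀ hr0] at hN
    rw [div_le_iff₀ hN0]
    linarith
  have chain : ∀ k : ℕ, k ≤ N → ∃ y : ℝ → State m, y 0 = x 0 + ((k : ℝ) / N) • (y₀ - x 0) ∧
      IsIntegralCurveOn y (fun t y => F t y + w t) (Icc 0 T) ∧
      ∀ t ∈ Icc 0 T, ‖y t - x t‖ ≤ k * (L / N * Real.exp (-(β / 8) * t)) := by
    intro k
    induction k with
    | zero => exact fun _ => ⟨x, by simp, hx, by simp⟩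
    | succ k ih =>
      intro hk
      obtain ⟨a, ha0, ha, hax⟩ := ih (by lia)
      have hkN : (k : ℝ) + 1 ≤ N := by exact_mod_cast hk
      obtain ⟨b, hb0, hb⟩ := hvex (x 0 + (((k + 1 : ℕ) : ℝ) / N) • (y₀ - x 0))
      have hexp : ∀ t ∈ Icc 0 T, Real.exp (-(β / 8) * t) ≤ 1 := fun t ht =>
        Real.exp_le_one_iff.2 (by nlinarith [ht.1])
      have haP : ∀ t ∈ Icc 0 T, ‖a t‖ ≤ P - r := by
        intro t ht
        have h1 : ‖a t‖ ≤ ‖x t‖ + ‖a t - x t‖ := norm_le_norm_add_norm_sub' _ _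
        have h2 : (k : ℝ) * (L / N * Real.exp (-(β / 8) * t)) ≤ L :=
          calc (k : ℝ) * (L / N * Real.exp (-(β / 8) * t)) ≤ N * (L / N * 1) := by
                gcongr
                · linarith
                · exact hexp t ht
            _ = L := by field_simp
        linarith [hax t ht, hBx t ht, min_le_right r₀ 1]
      have hab : b 0 - a 0 = (1 / N : ℝ) • (y₀ - x 0) := by
        rw [hb0, ha0, add_sub_add_left_eq_sub, ← sub_smul]
        congr 1
        push_cast
        ring
      have habn : ‖b 0 - a 0‖ ≤ D / N := by
        rw [hab, norm_smul, Real.norm_of_nonneg (by positivity), div_mul_eq_mul_div, one_mul]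
        gcongr
      -- The initial energy of one step, which is at most `ε r²` because `L / N ≤ r`.
      have hsq : C₀ * (D / N) ^ 2 = ε * (L / N) ^ 2 := by
        rw [hL, div_pow, div_pow, mul_pow, Real.sq_sqrt (by positivity)]
        field_simp
      have hest := mul_norm_sub_sq_le (g := fun t y => F t y + w t) (v := v) hM
        (T := T) (P := P) (r := r) (η := β * ε / (4 * (S + 1))) (S := S)
        (B₀ := C₀ * (D / N) ^ 2) hε hβ hr0.le (by positivity) hpos hvar
        (fun t ht y hy z hz hyz => by
          simpa using hlin t ht y hy z hz (hyz.trans (min_le_left _ _)))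
        (fun t ht y hy => (le_abs_self _).trans (hS (t, y) ⟨ht, hy⟩)) hS0
        (by
          rw [mul_div_assoc', div_le_iff₀ (by positivity)]
          nlinarith [mul_pos hβ hε])
        hv ha hb haP
        (by
          refine (le_abs_self _).trans ((abs_bilin_le _ _ _).trans ?_)
          rw [← sq]
          gcongr
          rw [ha0]
          exact hseg _ ⟨by positivity, (div_le_one hN0).2 (by linarith)⟩)
        (by rw [hsq]; gcongr)
      have hstep : ∀ t ∈ Icc 0 T, ‖b t - a t‖ ≤ L / N * Real.exp (-(β / 8) * t) := by
        intro t ht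
        have := norm_le_of_mul_sq_le (γ := β / 8) (c := C₀) (h := D / N) (s := t) hε hC₀.le (by positivity)
          ((hest t ht).trans_eq (by ring_nf))
        rwa [← mul_div_assoc] at this
      refine ⟨b, hb0, fun t ht => ?_, fun t ht => ?_⟩
      -- The decay estimate keeps `b` where the truncation is inactive, so `b` solves the original
      -- equation.
      · have hbP : b t ∈ Metric.closedBall (0 : State m) P := by
          have h1 : ‖b t‖ ≤ ‖a t‖ + ‖b t - a t‖ := norm_le_norm_add_norm_sub' _ _
          have h2 : L / N * Real.exp (-(β / 8) * t) ≤ L / N :=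
            mul_le_of_le_one_right (by positivity) (hexp t ht)
          simp only [mem_closedBall_zero_iff]
          linarith [haP t ht, hstep t ht]
        show HasDerivWithinAt b (F t (b t) + w t) _ _
        rw [← hv t _ hbP]
        exact hb t ht
      · have h1 : ‖b t - x t‖ ≤ ‖b t - a t‖ + ‖a t - x t‖ := norm_sub_le_norm_sub_add_norm_sub _ _ _
        push_cast
        linarith [hax t ht, hstep t ht]
  obtain ⟨y, hy0, hy, hyx⟩ := chain N le_rfl
  refine ⟨y, by simp [hy0, hN0.ne'], hy, fun t ht => (hyx t ht).trans_eq ?_⟩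
  field_simp

/-- Integral curves on `[0, n]` for all `n` fit together to one on `[0, ∞)`. -/
theorem exists_isIntegralCurveOn_Ici {E : Type*} [NormedAddCommGroup E] [InnerProductSpace ℝ E]
    [FiniteDimensional ℝ E] {F : ℝ → E → E}
    (hF : ContDiff ℝ 1 fun p : ℝ × E => F p.1 p.2) {w : ℝ → E} {y₀ : E}
    (h : ∀ n : ℕ, ∃ y : ℝ → E, y 0 = y₀ ∧
      IsIntegralCurveOn y (fun t y => F t y + w t) (Icc 0 n)) :
    ∃ y : ℝ → E, y 0 = y₀ ∧ IsIntegralCurveOn y (fun t y => F t y + w t) (Ici 0) := by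
  choose Y hY0 hY using h
  have hagree : ∀ k n : ℕ, k ≤ n → EqOn (Y k) (Y n) (Icc 0 k) := fun k n hkn =>
    eqOn_of_isIntegralCurveOn hF (hY k)
      ((hY n).mono (Icc_subset_Icc_right (by exact_mod_cast hkn))) (by rw [hY0, hY0])
  have hglue : ∀ n : ℕ, EqOn (fun t => Y (⌈t⌉₊) t) (Y n) (Icc 0 n) := fun n t ht =>
    hagree _ n (Nat.ceil_le.2 ht.2) ⟨ht.1, Nat.le_ceil t⟩
  refine ⟨fun t => Y (⌈t⌉₊) t, by simp [hY0], fun t ht => ?_⟩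
  -- With `⌈t⌉₊` alone, `t` could be the right endpoint and the derivative only one-sided; the extra
  -- 1 leaves room beyond `t`.
  have htn : t ∈ Ico (0 : ℝ) (⌈t⌉₊ + 1 : ℕ) :=
    ⟨ht, (Nat.le_ceil t).trans_lt (by push_cast; linarith)⟩
  have hd := (hY (⌈t⌉₊ + 1) t (Ico_subset_Icc_self htn)).congr_of_mem
    (hglue (⌈t⌉₊ + 1)) (Ico_subset_Icc_self htn)
  rw [← hglue (⌈t⌉₊ + 1) (Ico_subset_Icc_self htn)] at hd
  refine hd.mono_of_mem_nhdsWithin ?_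
  rw [← Ici_inter_Iic]
  exact inter_mem self_mem_nhdsWithin (mem_nhdsWithin_of_mem_nhds (Iic_mem_nhds htn.2))

/-- A solution of the first system is continuously differentiable. -/
theorem contDiffOn_of_isIntegralCurveOn {f : ℝ → State m → State m}
    (hf : ContDiff ℝ 1 fun p : ℝ × State m => f p.1 p.2) {x : ℝ → State m}
    (hx : IsIntegralCurveOn x f (Ici 0)) : ContDiffOn ℝ 1 x (Ici 0) := by
  rw [contDiffOn_one_iff_derivWithin (uniqueDiffOn_Ici 0)]
  refine ⟨fun t ht => (hx t ht).differentiableWithinAt, ?_⟩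
  have hc : ContinuousOn (fun t => f t (x t)) (Ici 0) :=
    hf.continuous.comp_continuousOn (continuousOn_id.prodMk hx.continuousOn)
  exact hc.congr fun t ht => (hx t ht).derivWithin (uniqueDiffOn_Ici 0 t ht)

end Synchronization

end Contraction

end

/-! ### The synchronization theorem. -/

theorem theorem3 {m : ℕ}
    (f : ℝ → Contraction.State m → Contraction.State m)
    (u : Contraction.State m → Contraction.State m)
    (hf : ContDiff ℝ 1 fun p : ℝ × Contraction.State m => f p.1 p.2)
    (hu : ContDiff ℝ 1 u)
    (hcontr : Contraction.IsContractingForAllInputs f u)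
    (x : ℝ → Contraction.State m)
    (hx : IsIntegralCurveOn x f (Ici 0)) :
    (∀ y₀ : Contraction.State m, ∃ y : ℝ → Contraction.State m,
      y 0 = y₀ ∧ IsIntegralCurveOn y (Contraction.drivenField f u x) (Ici 0)) ∧
    (∀ y : ℝ → Contraction.State m,
      IsIntegralCurveOn y (Contraction.drivenField f u x) (Ici 0) →
      Tendsto (fun t : ℝ => y t - x t) atTop (𝓝 0)) := by
  obtain ⟨M, ⟨hM, ε, hε, hpos⟩, β, hβ, hvar⟩ :=
    hcontr x (Contraction.contDiffOn_of_isIntegralCurveOn hf hx)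
  have hg : Contraction.drivenField f u x = fun t y => (f t y - u y) + u (x t) := by
    funext t y
    simp only [Contraction.drivenField]
    abel
  rw [hg] at hvar ⊢
  have hF : ContDiff ℝ 1 fun p : ℝ × Contraction.State m => f p.1 p.2 - u p.2 :=
    hf.sub (hu.comp contDiff_snd)
  have hw : ContinuousOn (fun t => u (x t)) (Ici 0) :=
    hu.continuous.comp_continuousOn hx.continuousOn
  have hx' : IsIntegralCurveOn x (fun t y => (f t y - u y) + u (x t)) (Ici 0) := fun t ht => by
    simpa using hx t ht
  have bound : ∀ y₀ : Contraction.State m, ∃ L : ℝ, ∀ T : ℝ, 0 ≤ T →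
      ∃ y : ℝ → Contraction.State m, y 0 = y₀ ∧
        IsIntegralCurveOn y (fun t y => (f t y - u y) + u (x t)) (Icc 0 T) ∧
        ∀ t ∈ Icc 0 T, ‖y t - x t‖ ≤ L * Real.exp (-(β / 8) * t) := by
    intro y₀
    have hMc : Continuous fun s : ℝ => ∑ i, ∑ j, |M 0 (x 0 + s • (y₀ - x 0)) i j| :=
      continuous_finsetSum _ fun i _ => continuous_finsetSum _ fun j _ =>
        ((hM i j).continuous.comp (by fun_prop :
          Continuous fun s : ℝ => ((0 : ℝ), x 0 + s • (y₀ - x 0)))).abs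
    obtain ⟨C, hC⟩ := (isCompact_Icc (a := (0 : ℝ)) (b := 1)).exists_bound_of_continuousOn
      hMc.continuousOn
    -- `C₀` and `D` are chosen before `T`, so `L` is independent of it. The `max` with 1 and the
    -- added 1 keep them positive, even when `y₀ = x 0`.
    exact ⟨_, fun T hT => Contraction.exists_isIntegralCurveOn_norm_sub_le hF hM hT hε hβ
      (C₀ := max C 1) (D := ‖y₀ - x 0‖ + 1) (by positivity) (by positivity) hpos
      (fun t ht y => hvar t ht y (mem_univ y)) (hw.mono Icc_subset_Ici_self)
      (hx'.mono Icc_subset_Ici_self) (by linarith)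
      (fun s hs => (le_abs_self _).trans ((hC s hs).trans (le_max_left _ _)))⟩
  refine ⟨fun y₀ => ?_, fun y hy => ?_⟩
  · obtain ⟨L, hL⟩ := bound y₀
    refine Contraction.exists_isIntegralCurveOn_Ici hF fun n => ?_
    obtain ⟨y, h0, hy, -⟩ := hL n n.cast_nonneg
    exact ⟨y, h0, hy⟩
  · obtain ⟨L, hL⟩ := bound (y 0)
    have hle : ∀ t : ℝ, 0 ≤ t → ‖y t - x t‖ ≤ L * Real.exp (-(β / 8) * t) := by
      intro t ht
      -- Taking horizon `T = t` and using uniqueness on `[0, t]` transfers the bound to the given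
      -- solution.
      obtain ⟨z, hz0, hz, hzx⟩ := hL t ht
      have hyz := Contraction.eqOn_of_isIntegralCurveOn hF (hy.mono Icc_subset_Ici_self) hz hz0.symm
      rw [hyz ⟨ht, le_rfl⟩]
      exact hzx t ⟨ht, le_rfl⟩
    refine squeeze_zero_norm' ((eventually_ge_atTop 0).mono hle) ?_
    have hlim : Tendsto (fun t : ℝ => Real.exp (-(β / 8) * t)) atTop (𝓝 0) :=
      Real.tendsto_exp_atBot.comp (tendsto_id.const_mul_atTop_of_neg (by linarith))
    simpa using hlim.const_mul L
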